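/- Let $I\subseteq\mathbb{R}$ be an interval (for instance $I=\mathbb{R}$, or a bounded interval). A \emph{cloud} $[\delta,\pi]$ on $I$ is a pair of maps $\delta,\pi:I\to[0,1]$ with $\delta\le\pi$, $\pi(r)=1$ for at least one $r$ and $\delta(r')=0$ for at least one $r'$. It is \emph{comonotonic} if $\delta(x)<\delta(y)$ implies $\pi(x)\le\pi(y)$ for all $x,y\in I$. Its credal set $\mathcal{P}_{[\delta,\pi]}$ is the set of all ($\sigma$-additive) Borel probability measures $P$ on $I$ such that $$P(\{r:\delta(r)\ge\alpha\})\le 1-\alpha\le P(\{r:\pi(r)>\alpha\})\qquad\text{for all }\alpha\in[0,1].$$ A family $(E_\alpha)_{\alpha\in[0,1]}$ of subsets of $I$ is called a \emph{continuous random set with uniform mass density} if $\{\alpha\in[0,1]:E_\alpha\subseteq A\}$ is Lebesgue measurable for every Borel set $A\subseteq I$ and the empty set has mass zero, i.e. $\{\alpha\in[0,1]:E_\alpha=\emptyset\}$ has Lebesgue measure zero. Its belief function is $Bel(A)=\lambda(\{\alpha\in[0,1]:E_\alpha\subseteq A\})$, where $\lambda$ is Lebesgue measure, and its credal set is the set of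 all Borel probability measures $P$ on $I$ with $Bel(A)\le P(A)$ for every Borel set $A\subseteq I$. Let $[\delta,\pi]$ be a comonotonic cloud on $I$ with $\delta$ and $\pi$ continuous. (a) Let $E_\alpha=\{r\in I:\pi(r)\ge\alpha,\ \delta(r)<\alpha\}$ for $\alpha\in[0,1]$, and suppose that $E_\alpha\neq\emptyset$ for Lebesgue-almost every $\alpha\in[0,1]$. Then $(E_\alpha)_{\alpha\in[0,1]}$ is a continuous random set with uniform mass density, and its credal set is $\mathcal{P}_{[\delta,\pi]}$. (b) Without that supposition (thus also for thin clouds, $\delta=\pi$), the closed sets $\overline{E}_\alpha=\{r\in I:\pi(r)\ge\alpha,\ \delta(r)\le\alpha\}$, $\alpha\in[0,1]$, form a continuous random set with uniform mass density, and its credal set is $\mathcal{P}_{[\delta,\pi]}$. -/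

import Mathlib

open MeasureTheory Set

noncomputable section

namespace Clouds

/-- A cloud `[δ, π]` on `X`: two maps into the unit interval with `δ ≤ π`, where `π` takes the
value `1` and `δ` takes the value `0`. -/
structure IsCloud {X : Type*} (δ π : X → ℝ) : Prop where
  lower_nonneg : ∀ x, 0 ≤ δ x
  lower_le_upper : ∀ x, δ x ≤ π x
  upper_le_one : ∀ x, π x ≤ 1
  exists_upper_eq_one : ∃ x, π x = 1
  exists_lower_eq_zero : ∃ y, δ y = 0

/-- The two distributions of the cloud are comonotonic. -/
def IsComonotonic {X : Type*} (δ π : X → ℝ) : Prop :=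
  ∀ x y, δ x < δ y → π x ≤ π y

/-- The credal set of a cloud: the (σ-additive) probability measures `P` with
`P (δ ≥ α) ≤ 1 - α ≤ P (π > α)` for all levels `α ∈ [0, 1]`. -/
def cloudCredalSet {X : Type*} [MeasurableSpace X] (δ π : X → ℝ) : Set (ProbabilityMeasure X) :=
  {P | ∀ α ∈ Icc (0 : ℝ) 1,
    (P : Measure X) {x | α ≤ δ x} ≤ ENNReal.ofReal (1 - α) ∧
    ENNReal.ofReal (1 - α) ≤ (P : Measure X) {x | α < π x}}

/-- The multimapping `α ↦ E α`, with Lebesgue measure on `[0, 1]` as mass density, is a random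
set: the events `E α ⊆ A` are Lebesgue measurable, and the empty set carries no mass. -/
structure IsRandomSet {X : Type*} [MeasurableSpace X] (E : ℝ → Set X) : Prop where
  nullMeasurableSet_subset : ∀ A : Set X, MeasurableSet A →
    NullMeasurableSet {α | α ∈ Icc (0 : ℝ) 1 ∧ E α ⊆ A} volume
  mass_empty : volume {α | α ∈ Icc (0 : ℝ) 1 ∧ E α = ∅} = 0

/-- The belief function of the random set with uniform mass density on `[0, 1]`:
`Bel A` is the mass of the focal sets contained in `A`. -/
def belief {X : Type*} (E : ℝ → Set X) (A : Set X) : ENNReal :=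
  volume {α | α ∈ Icc (0 : ℝ) 1 ∧ E α ⊆ A}

/-- The credal set of the random set: the probability measures that dominate its belief
function. -/
def beliefCredalSet {X : Type*} [MeasurableSpace X] (E : ℝ → Set X) :
    Set (ProbabilityMeasure X) :=
  {P | ∀ A : Set X, MeasurableSet A → belief E A ≤ (P : Measure X) A}

/-- The focal sets `E_α = {π ≥ α, δ < α}`. -/
def focalSet {X : Type*} (δ π : X → ℝ) (α : ℝ) : Set X :=
  {x | α ≤ π x ∧ δ x < α}

/-- The closed focal sets `{π ≥ α, δ ≤ α}`; for a thin cloud these are the sets `{π = α}`. -/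
def closedFocalSet {X : Type*} (δ π : X → ℝ) (α : ℝ) : Set X :=
  {x | α ≤ π x ∧ δ x ≤ α}

end Clouds

end

/-!
The belief constraints of `{δ < α}` and `{α < π}` are the cloud constraints, which gives one
inclusion. Conversely, let `P` belong to the credal set of the cloud. By comonotonicity `δ` and `π`
are both nondecreasing functions of the rank `δ + π`. If the quantile function of the law of the
rank takes the value `δ x + π x` at `u`, then the cloud constraints force `δ x ≤ u ≤ π x`. As the
quantile function transports Lebesgue measure on `(0, 1)` to the law of the rank, the levels whose
focal set meets `B` have mass at least `P B`; this is the belief inequality for the complement of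
`B`.

The set of levels whose focal set meets `B` is the projection of a Borel set, hence analytic, and
it need not be Borel for thin clouds; it is Lebesgue measurable because finite measures can be
approximated on analytic sets by compact subsets.

If `{δ < α ≤ π}` is contained in `A` and nonempty but `{δ ≤ α ≤ π}` is not contained in `A`, then
`α` is isolated on one side in a set of levels, and there are only countably many such `α`.
-/

namespace Clouds

open Filter Topology ProbabilityTheory Function
open scoped ENNReal

section AnalyticSets

theorem exists_pi_Iio_Iic_subset_of_pi_univ_Iic_subset {U : Set (ℕ → ℕ)} (hU : IsOpen U)
    {N : ℕ → ℕ} (h : univ.pi (fun i => Iic (N i)) ⊆ U) :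
    ∃ n, (Iio n).pi (fun i => Iic (N i)) ⊆ U := by
  let := PiNat.metricSpaceNatNat
  have hK : IsCompact (univ.pi fun i => Iic (N i)) :=
    isCompact_univ_pi fun i => (finite_Iic (N i)).isCompact
  obtain ⟨ε, hε, hεU⟩ := hK.exists_thickening_subset_open hU h
  obtain ⟨n, hn⟩ := exists_pow_lt_of_lt_one hε (one_half_lt_one (α := ℝ))
  -- Truncating a point of the cylinder at `N` moves it into the box by at most `(1 / 2) ^ n`.
  refine ⟨n, fun x hx => hεU (Metric.mem_thickening_iff.2 ⟨fun i => min (x i) (N i),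
    fun i _ => min_le_right (x i) (N i), lt_of_le_of_lt ?_ hn⟩)⟩
  rw [← PiNat.mem_cylinder_iff_dist_le]
  exact fun i hi => (min_eq_left (hx i hi)).symm

variable {α : Type*} [MeasurableSpace α] {μ : Measure α} {r : ℝ≥0∞}

theorem exists_lt_measure_image_inter_preimage_Iic {β : Type*} {f : β → α} {A : Set β}
    (h : r < μ (f '' A)) (g : β → ℕ) : ∃ k, r < μ (f '' (A ∩ g ⁻¹' Iic k)) := by
  have hunion : f '' A = ⋃ k, f '' (A ∩ g ⁻¹' Iic k) := by
    rw [← image_iUnion, ← inter_iUnion, ← preimage_iUnion, iUnion_Iic, preimage_univ, inter_univ]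
  have hmono : Monotone fun k => f '' (A ∩ g ⁻¹' Iic k) := fun k l hkl =>
    image_mono (inter_subset_inter_right A (preimage_mono (Iic_subset_Iic.2 hkl)))
  rwa [hunion, hmono.measure_iUnion, lt_iSup_iff] at h

theorem exists_forall_lt_measure_image_pi_Iio_Iic {f : (ℕ → ℕ) → α} (h : r < μ (range f)) :
    ∃ N : ℕ → ℕ, ∀ n, r < μ (f '' (Iio n).pi fun i => Iic (N i)) := by
  choose! bound hbound using fun (A : Set (ℕ → ℕ)) (n : ℕ) (hA : r < μ (f '' A)) =>
    exists_lt_measure_image_inter_preimage_Iic hA (eval n)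
  let A (n : ℕ) : Set (ℕ → ℕ) :=
    n.rec univ fun n B => B ∩ eval n ⁻¹' Iic (bound B n)
  have hlt (n : ℕ) : r < μ (f '' A n) := by
    induction n with
    | zero => simpa [A] using h
    | succ n ih => exact hbound _ n ih
  have hA (n : ℕ) : A n = (Iio n).pi fun i => Iic (bound (A i) i) := by
    induction n with
    | zero => simp [A]
    | succ n ih =>
      rw [← Order.succ_eq_add_one, Order.Iio_succ_eq_insert, insert_pi, ← ih, inter_comm]
      rfl
  exact ⟨fun i => bound (A i) i, fun n => hA n ▸ hlt n⟩

variable [TopologicalSpace α] [μ.OuterRegular] {s : Set α}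

theorem exists_isCompact_subset_le_measure_of_analyticSet (hs : AnalyticSet s) (hr : r < μ s) :
    ∃ K ⊆ s, IsCompact K ∧ r ≤ μ K := by
  rw [AnalyticSet] at hs
  obtain rfl | ⟨f, hf, rfl⟩ := hs
  · simp at hr
  obtain ⟨N, hN⟩ := exists_forall_lt_measure_image_pi_Iio_Iic hr
  have hK : IsCompact (univ.pi fun i => Iic (N i)) :=
    isCompact_univ_pi fun i => (finite_Iic (N i)).isCompact
  refine ⟨f '' univ.pi fun i => Iic (N i), image_subset_range _ _, hK.image hf,
    le_of_forall_gt fun c hc => ?_⟩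
  obtain ⟨O, hKO, hO, hOc⟩ := exists_isOpen_lt_of_lt _ c hc
  obtain ⟨n, hn⟩ := exists_pi_Iio_Iic_subset_of_pi_univ_Iic_subset (hO.preimage hf)
    (image_subset_iff.1 hKO)
  calc r < μ (f '' (Iio n).pi fun i => Iic (N i)) := hN n
    _ ≤ μ O := measure_mono (image_subset_iff.2 hn)
    _ < c := hOc

theorem nullMeasurableSet_of_analyticSet [T2Space α] [OpensMeasurableSpace α] [SFinite μ]
    (hs : AnalyticSet s) (hμs : μ s ≠ ∞) : NullMeasurableSet s μ := by
  -- `Tᶜ` is a measurable kernel of `s`: every measurable subset of `s` is almost contained in it.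
  set T := toMeasurable μ sᶜ
  have hTs : Tᶜ ⊆ s := compl_subset_comm.1 (subset_toMeasurable μ sᶜ)
  have hT : MeasurableSet Tᶜ := (measurableSet_toMeasurable μ sᶜ).compl
  have hle : μ s ≤ μ Tᶜ := by
    refine le_of_forall_lt_imp_le_of_dense fun r hr => ?_
    obtain ⟨K, hKs, hK, hrK⟩ := exists_isCompact_subset_le_measure_of_analyticSet hs hr
    have hTK : μ (K ∩ T) = 0 := by
      rw [inter_comm, Measure.measure_toMeasurable_inter_of_sFinite hK.measurableSet,
        (disjoint_compl_left_iff_subset.2 hKs).inter_eq, measure_empty]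
    calc r ≤ μ K := hrK
      _ ≤ μ (K ∩ T) + μ (K \ T) := measure_le_inter_add_sdiff μ K T
      _ = μ (K \ T) := by rw [hTK, zero_add]
      _ ≤ μ Tᶜ := measure_mono fun _ hx => hx.2
  exact hT.nullMeasurableSet.congr
    (ae_eq_of_subset_of_measure_ge hTs hle hT.nullMeasurableSet hμs)

theorem nullMeasurableSet_image [T2Space α] [SecondCountableTopology α] [OpensMeasurableSpace α]
    [SFinite μ] {X : Type*} [MeasurableSpace X] [StandardBorelSpace X] {f : X → α}
    (hf : Measurable f) {B : Set X} (hB : MeasurableSet B) (hμB : μ (f '' B) ≠ ∞) :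
    NullMeasurableSet (f '' B) μ :=
  nullMeasurableSet_of_analyticSet (hB.analyticSet_image hf) hμB

end AnalyticSets

section Quantile

/-- The quantile function of a measure on the line: the generalized inverse of its distribution
function. It is meaningful at levels in the open interval `(0, 1)`; outside, the infimum may be
taken over an empty or unbounded set. -/
noncomputable def quantile (Q : Measure ℝ) (u : ℝ) : ℝ :=
  sInf {t | u ≤ cdf Q t}

variable (Q : Measure ℝ) {u : ℝ}

theorem quantile_le_iff (hu : u ∈ Ioo (0 : ℝ) 1) (t : ℝ) : quantile Q u ≤ t ↔ u ≤ cdf Q t := by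
  have hne : {t | u ≤ cdf Q t}.Nonempty :=
    ((tendsto_cdf_atTop Q).eventually (eventually_ge_nhds hu.2)).exists
  have hbdd : BddBelow {t | u ≤ cdf Q t} := by
    obtain ⟨b, hb⟩ := ((tendsto_cdf_atBot Q).eventually (eventually_lt_nhds hu.1)).exists
    exact ⟨b, fun t ht => ((monotone_cdf Q).reflect_lt (hb.trans_le ht)).le⟩
  refine ⟨fun h => ?_, fun h => csInf_le hbdd h⟩
  have hright : Tendsto (cdf Q) (𝓝[>] t) (𝓝 (cdf Q t)) :=
    ((cdf Q).right_continuous t).mono_left (nhdsWithin_mono _ Ioi_subset_Ici_self)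
  refine ge_of_tendsto hright ?_
  filter_upwards [self_mem_nhdsWithin] with v hv
  obtain ⟨w, hw, hwv⟩ := exists_lt_of_csInf_lt hne (h.trans_lt hv)
  exact hw.trans (monotone_cdf Q hwv.le)

theorem monotoneOn_quantile : MonotoneOn (quantile Q) (Ioo 0 1) := fun _ hu _ hv huv =>
  (quantile_le_iff Q hu _).2 (huv.trans ((quantile_le_iff Q hv _).1 le_rfl))

theorem aemeasurable_quantile : AEMeasurable (quantile Q) (volume.restrict (Ioo 0 1)) :=
  aemeasurable_restrict_of_monotoneOn measurableSet_Ioo (monotoneOn_quantile Q)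

variable [IsProbabilityMeasure Q]

theorem map_quantile : (volume.restrict (Ioo 0 1)).map (quantile Q) = Q := by
  refine Measure.ext_of_Iic _ _ fun t => ?_
  have hpreimage : quantile Q ⁻¹' Iic t ∩ Ioo 0 1 = Iic (cdf Q t) ∩ Ioo 0 1 := by
    ext u
    exact and_congr_left fun hu => quantile_le_iff Q hu t
  rw [Measure.map_apply_of_aemeasurable (aemeasurable_quantile Q) measurableSet_Iic,
    Measure.restrict_apply' measurableSet_Ioo, hpreimage, ← ofReal_cdf]
  refine le_antisymm ?_ ?_
  · calc volume (Iic (cdf Q t) ∩ Ioo 0 1) ≤ volume (Icc 0 (cdf Q t)) :=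
        measure_mono fun u hu => ⟨hu.2.1.le, hu.1⟩
      _ = ENNReal.ofReal (cdf Q t) := by simp
  · calc ENNReal.ofReal (cdf Q t) = volume (Ioo 0 (cdf Q t)) := by simp
      _ ≤ volume (Iic (cdf Q t) ∩ Ioo 0 1) :=
        measure_mono fun u hu => ⟨hu.2.le, hu.1, hu.2.trans_le (cdf_le_one Q t)⟩

theorem ofReal_le_measure_Iic_quantile (hu : u ∈ Ioo (0 : ℝ) 1) :
    ENNReal.ofReal u ≤ Q (Iic (quantile Q u)) := by
  rw [← ofReal_cdf]
  exact ENNReal.ofReal_le_ofReal ((quantile_le_iff Q hu _).1 le_rfl)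

theorem measure_Iio_quantile_le_ofReal (hu : u ∈ Ioo (0 : ℝ) 1) :
    Q (Iio (quantile Q u)) ≤ ENNReal.ofReal u := by
  have hleft : leftLim (cdf Q) (quantile Q u) ≤ u := by
    refine le_of_tendsto ((monotone_cdf Q).tendsto_leftLim _) ?_
    filter_upwards [self_mem_nhdsWithin] with t ht
    exact (lt_of_not_ge fun h => ((quantile_le_iff Q hu t).2 h).not_gt ht).le
  calc Q (Iio (quantile Q u)) = (cdf Q).measure (Iio (quantile Q u)) := by rw [measure_cdf]
    _ = ENNReal.ofReal (leftLim (cdf Q) (quantile Q u)) := by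
      rw [(cdf Q).measure_Iio (tendsto_cdf_atBot Q), sub_zero]
    _ ≤ ENNReal.ofReal u := ENNReal.ofReal_le_ofReal hleft

end Quantile

section RandomSets

/-- The plausibility function of the random set with uniform mass density on `[0, 1]`, conjugate
to `belief`: the mass of the focal sets that meet `A`. -/
noncomputable def plausibility {X : Type*} (E : ℝ → Set X) (A : Set X) : ℝ≥0∞ :=
  volume {α | α ∈ Icc (0 : ℝ) 1 ∧ (E α ∩ A).Nonempty}

theorem setOf_subset_eq_sdiff {X : Type*} (E : ℝ → Set X) (A : Set X) :
    {α | α ∈ Icc (0 : ℝ) 1 ∧ E α ⊆ A} =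
      Icc (0 : ℝ) 1 \ {α | α ∈ Icc (0 : ℝ) 1 ∧ (E α ∩ Aᶜ).Nonempty} := by
  ext α
  simp only [Set.mem_sdiff, mem_ofPred_eq, inter_compl_nonempty_iff]
  tauto

variable {X : Type*} [MeasurableSpace X] [StandardBorelSpace X] {E : ℝ → Set X} {A : Set X}

theorem nullMeasurableSet_setOf_inter_nonempty
    (hE : MeasurableSet {p : ℝ × X | p.2 ∈ E p.1}) (hA : MeasurableSet A) :
    NullMeasurableSet {α | α ∈ Icc (0 : ℝ) 1 ∧ (E α ∩ A).Nonempty} volume := by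
  have himage : {α | α ∈ Icc (0 : ℝ) 1 ∧ (E α ∩ A).Nonempty} =
      Prod.fst '' (Icc (0 : ℝ) 1 ×ˢ A ∩ {p : ℝ × X | p.2 ∈ E p.1}) := by
    ext α
    constructor
    · rintro ⟨hα, x, hxE, hxA⟩
      exact ⟨(α, x), ⟨⟨hα, hxA⟩, hxE⟩, rfl⟩
    · rintro ⟨p, ⟨⟨hα, hxA⟩, hxE⟩, rfl⟩
      exact ⟨hα, p.2, hxE, hxA⟩
  have hfinite : volume {α | α ∈ Icc (0 : ℝ) 1 ∧ (E α ∩ A).Nonempty} ≠ ∞ :=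
    measure_ne_top_of_subset (fun _ hα => hα.1) (measure_Icc_lt_top (a := (0 : ℝ)) (b := 1)).ne
  rw [himage] at hfinite ⊢
  exact nullMeasurableSet_image measurable_fst ((measurableSet_Icc.prod hA).inter hE) hfinite

theorem nullMeasurableSet_setOf_subset
    (hE : MeasurableSet {p : ℝ × X | p.2 ∈ E p.1}) (hA : MeasurableSet A) :
    NullMeasurableSet {α | α ∈ Icc (0 : ℝ) 1 ∧ E α ⊆ A} volume := by
  rw [setOf_subset_eq_sdiff]
  exact measurableSet_Icc.nullMeasurableSet.diff
    (nullMeasurableSet_setOf_inter_nonempty hE hA.compl)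

theorem belief_eq_one_sub_plausibility_compl
    (hE : MeasurableSet {p : ℝ × X | p.2 ∈ E p.1}) (hA : MeasurableSet A) :
    belief E A = 1 - plausibility E Aᶜ := by
  have hsub : {α | α ∈ Icc (0 : ℝ) 1 ∧ (E α ∩ Aᶜ).Nonempty} ⊆ Icc 0 1 := fun _ hα => hα.1
  rw [belief, plausibility, setOf_subset_eq_sdiff, measure_sdiff hsub
    (nullMeasurableSet_setOf_inter_nonempty hE hA.compl)
    (measure_ne_top_of_subset hsub measure_Icc_lt_top.ne), Real.volume_Icc, sub_zero,
    ENNReal.ofReal_one]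

theorem mem_beliefCredalSet_of_forall_le_plausibility
    (hE : MeasurableSet {p : ℝ × X | p.2 ∈ E p.1}) {P : ProbabilityMeasure X}
    (hP : ∀ B, MeasurableSet B → (P : Measure X) B ≤ plausibility E B) :
    P ∈ beliefCredalSet E := by
  intro A hA
  calc belief E A = 1 - plausibility E Aᶜ := belief_eq_one_sub_plausibility_compl hE hA
    _ ≤ 1 - (P : Measure X) Aᶜ := tsub_le_tsub_left (hP _ hA.compl) 1
    _ = (P : Measure X) A := by rw [← prob_compl_eq_one_sub hA.compl, compl_compl]

end RandomSets

theorem prob_le_ofReal_one_sub_iff {X : Type*} [MeasurableSpace X] {P : Measure X}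
    [IsProbabilityMeasure P] {s : Set X} (hs : MeasurableSet s) {a : ℝ} (ha : a ∈ Icc (0 : ℝ) 1) :
    P s ≤ ENNReal.ofReal (1 - a) ↔ ENNReal.ofReal a ≤ P sᶜ := by
  rw [← ofReal_measureReal, ← ofReal_measureReal, probReal_compl_eq_one_sub hs,
    ENNReal.ofReal_le_ofReal_iff (sub_nonneg.2 ha.2),
    ENNReal.ofReal_le_ofReal_iff (sub_nonneg.2 measureReal_le_one), le_sub_comm]

section ComonotonicClouds

variable {X : Type*} {δ π : X → ℝ}

theorem IsCloud.lower_mem_Icc (h : IsCloud δ π) (x : X) : δ x ∈ Icc (0 : ℝ) 1 :=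
  ⟨h.lower_nonneg x, (h.lower_le_upper x).trans (h.upper_le_one x)⟩

theorem IsCloud.upper_mem_Icc (h : IsCloud δ π) (x : X) : π x ∈ Icc (0 : ℝ) 1 :=
  ⟨(h.lower_nonneg x).trans (h.lower_le_upper x), h.upper_le_one x⟩

theorem IsComonotonic.le_of_add_le_add (h : IsComonotonic δ π) {x y : X}
    (hxy : δ x + π x ≤ δ y + π y) : δ x ≤ δ y ∧ π x ≤ π y := by
  refine ⟨le_of_not_gt fun hlt => ?_, le_of_not_gt fun hlt => ?_⟩
  · linarith [h y x hlt]
  · exact (h x y (by linarith)).not_gt hlt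

theorem focalSet_subset_closedFocalSet (δ π : X → ℝ) (α : ℝ) :
    focalSet δ π α ⊆ closedFocalSet δ π α := fun _ hx => ⟨hx.1, hx.2.le⟩

theorem IsComonotonic.countable_setOf_thin (hcom : IsComonotonic δ π) :
    {α | (∃ x, δ x = α ∧ π x = α) ∧ (focalSet δ π α).Nonempty}.Countable := by
  refine (countable_setOfPred_isolated_left_within (s := {α | ∃ x, δ x = α ∧ π x = α})).mono ?_
  rintro α ⟨⟨x, hδx, hπx⟩, y, hπy, hδy⟩
  refine ⟨⟨x, hδx, hπx⟩, empty_mem_iff_bot.1 <|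
    mem_nhdsWithin.2 ⟨Ioi (δ y), isOpen_Ioi, hδy, ?_⟩⟩
  rintro β ⟨hyβ, ⟨z, hδz, hπz⟩, hβα⟩
  have hπyz : π y ≤ π z := hcom y z (hδz ▸ hyβ)
  exact absurd (hπy.trans (hπyz.trans_eq hπz)) (not_le.2 hβα)

theorem countable_setOf_focalSet_subset_of_lower_eq_lt_upper (δ π : X → ℝ) (A : Set X) :
    {α | focalSet δ π α ⊆ A ∧ ∃ x ∉ A, δ x = α ∧ α < π x}.Countable := by
  refine (countable_setOfPred_isolated_right_within (s := {α | focalSet δ π α ⊆ A})).mono ?_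
  rintro α ⟨hαA, x, hxA, hδx, hπx⟩
  refine ⟨hαA, empty_mem_iff_bot.1 <| mem_nhdsWithin.2 ⟨Iio (π x), isOpen_Iio, hπx, ?_⟩⟩
  rintro β ⟨hβπ, hβA, hαβ⟩
  exact hxA (hβA ⟨le_of_lt hβπ, hδx.trans_lt hαβ⟩)

theorem IsComonotonic.setOf_closedFocalSet_subset_ae_eq (hcom : IsComonotonic δ π)
    (hempty : volume {α | α ∈ Icc (0 : ℝ) 1 ∧ focalSet δ π α = ∅} = 0) (A : Set X) :
    ({α | α ∈ Icc (0 : ℝ) 1 ∧ closedFocalSet δ π α ⊆ A} : Set ℝ) =ᵐ[volume]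
      ({α | α ∈ Icc (0 : ℝ) 1 ∧ focalSet δ π α ⊆ A} : Set ℝ) := by
  have hsub : {α | α ∈ Icc (0 : ℝ) 1 ∧ closedFocalSet δ π α ⊆ A} ⊆
      {α | α ∈ Icc (0 : ℝ) 1 ∧ focalSet δ π α ⊆ A} :=
    fun α hα => ⟨hα.1, (focalSet_subset_closedFocalSet δ π α).trans hα.2⟩
  have hcountable := hcom.countable_setOf_thin.union
    (countable_setOf_focalSet_subset_of_lower_eq_lt_upper δ π A)
  refine hsub.eventuallyLE.antisymm (ae_le_set.2 (measure_mono_null ?_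
    (measure_union_null hempty (hcountable.measure_zero volume))))
  rintro α ⟨⟨hα, hαA⟩, hclosed⟩
  obtain ⟨x, ⟨hπx, hδx⟩, hxA⟩ := Set.not_subset.1 fun h => hclosed ⟨hα, h⟩
  have hδx : δ x = α := hδx.antisymm (not_lt.1 fun h => hxA (hαA ⟨hπx, h⟩))
  rcases (focalSet δ π α).eq_empty_or_nonempty with hαempty | hαne
  · exact Or.inl ⟨hα, hαempty⟩
  rcases hπx.eq_or_lt with hπx | hπx
  · exact Or.inr (Or.inl ⟨⟨x, hδx, hπx.symm⟩, hαne⟩)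
  · exact Or.inr (Or.inr ⟨hαA, x, hxA, hδx, hπx⟩)

variable [MeasurableSpace X] {P : ProbabilityMeasure X}

theorem beliefCredalSet_subset_cloudCredalSet (hδ : Measurable δ) (hπ : Measurable π)
    {E : ℝ → Set X} (hE : ∀ α, E α ⊆ closedFocalSet δ π α) :
    beliefCredalSet E ⊆ cloudCredalSet δ π := by
  intro P hP α hα
  have hlower : MeasurableSet {x | α ≤ δ x} := measurableSet_le measurable_const hδ
  rw [prob_le_ofReal_one_sub_iff hlower hα]
  constructor
  · calc ENNReal.ofReal α = volume (Ico 0 α) := by simp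
      _ ≤ belief E {x | α ≤ δ x}ᶜ := measure_mono fun β hβ =>
        ⟨⟨hβ.1, hβ.2.le.trans hα.2⟩, fun x hx => not_le.2 ((hE β hx).2.trans_lt hβ.2)⟩
      _ ≤ (P : Measure X) {x | α ≤ δ x}ᶜ := hP _ hlower.compl
  · calc ENNReal.ofReal (1 - α) = volume (Ioc α 1) := by simp
      _ ≤ belief E {x | α < π x} := measure_mono fun β hβ =>
        ⟨⟨hα.1.trans hβ.1.le, hβ.2⟩, fun x hx => hβ.1.trans_le (hE β hx).1⟩
      _ ≤ (P : Measure X) {x | α < π x} := hP _ (measurableSet_lt measurable_const hπ)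

theorem measurableSet_setOf_mem_closedFocalSet (hδ : Measurable δ) (hπ : Measurable π) :
    MeasurableSet {p : ℝ × X | p.2 ∈ closedFocalSet δ π p.1} :=
  (measurableSet_le measurable_fst (hπ.comp measurable_snd)).inter
    (measurableSet_le (hδ.comp measurable_snd) measurable_fst)

theorem measure_setOf_add_le_le_ofReal_upper (hcloud : IsCloud δ π) (hcom : IsComonotonic δ π)
    (hπ : Measurable π) (hP : P ∈ cloudCredalSet δ π) (x : X) :
    (P : Measure X) {y | δ y + π y ≤ δ x + π x} ≤ ENNReal.ofReal (π x) := by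
  have hx := hcloud.upper_mem_Icc x
  have hm : MeasurableSet {y | π y ≤ π x} := measurableSet_le hπ measurable_const
  calc (P : Measure X) {y | δ y + π y ≤ δ x + π x}
      ≤ (P : Measure X) {y | π y ≤ π x} := measure_mono fun y hy => (hcom.le_of_add_le_add hy).2
    _ ≤ ENNReal.ofReal (1 - (1 - π x)) := by
      rw [prob_le_ofReal_one_sub_iff hm ⟨sub_nonneg.2 hx.2, sub_le_self 1 hx.1⟩]
      simpa only [compl_ofPred, not_le] using (hP _ hx).2
    _ = ENNReal.ofReal (π x) := by rw [sub_sub_cancel]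

theorem ofReal_lower_le_measure_setOf_add_lt (hcloud : IsCloud δ π) (hcom : IsComonotonic δ π)
    (hδ : Measurable δ) (hP : P ∈ cloudCredalSet δ π) (x : X) :
    ENNReal.ofReal (δ x) ≤ (P : Measure X) {y | δ y + π y < δ x + π x} := by
  have hx := hcloud.lower_mem_Icc x
  have hm : MeasurableSet {y | δ x ≤ δ y} := measurableSet_le measurable_const hδ
  calc ENNReal.ofReal (δ x) ≤ (P : Measure X) {y | δ x ≤ δ y}ᶜ :=
        (prob_le_ofReal_one_sub_iff hm hx).1 (hP _ hx).1
    _ ≤ (P : Measure X) {y | δ y + π y < δ x + π x} :=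
      measure_mono fun y hy => lt_of_not_ge fun h => hy (hcom.le_of_add_le_add h).1

theorem mem_closedFocalSet_of_quantile_eq_add (hcloud : IsCloud δ π) (hcom : IsComonotonic δ π)
    (hδ : Measurable δ) (hπ : Measurable π) (hP : P ∈ cloudCredalSet δ π) {u : ℝ}
    (hu : u ∈ Ioo (0 : ℝ) 1) {x : X}
    (hx : quantile ((P : Measure X).map (δ + π)) u = δ x + π x) : x ∈ closedFocalSet δ π u := by
  have hrank : Measurable (δ + π) := hδ.add hπ
  have := Measure.isProbabilityMeasure_map (μ := (P : Measure X)) hrank.aemeasurable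
  constructor
  · rw [← ENNReal.ofReal_le_ofReal_iff (hcloud.upper_mem_Icc x).1]
    calc ENNReal.ofReal u ≤ (P : Measure X).map (δ + π) (Iic (δ x + π x)) :=
          hx ▸ ofReal_le_measure_Iic_quantile _ hu
      _ = (P : Measure X) {y | δ y + π y ≤ δ x + π x} := Measure.map_apply hrank measurableSet_Iic
      _ ≤ ENNReal.ofReal (π x) := measure_setOf_add_le_le_ofReal_upper hcloud hcom hπ hP x
  · rw [← ENNReal.ofReal_le_ofReal_iff hu.1.le]
    calc ENNReal.ofReal (δ x) ≤ (P : Measure X) {y | δ y + π y < δ x + π x} :=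
          ofReal_lower_le_measure_setOf_add_lt hcloud hcom hδ hP x
      _ = (P : Measure X).map (δ + π) (Iio (δ x + π x)) :=
        (Measure.map_apply hrank measurableSet_Iio).symm
      _ ≤ ENNReal.ofReal u := hx ▸ measure_Iio_quantile_le_ofReal _ hu

variable [StandardBorelSpace X]

theorem measure_le_plausibility_closedFocalSet (hcloud : IsCloud δ π) (hcom : IsComonotonic δ π)
    (hδ : Measurable δ) (hπ : Measurable π) (hP : P ∈ cloudCredalSet δ π) {B : Set X}
    (hB : MeasurableSet B) : (P : Measure X) B ≤ plausibility (closedFocalSet δ π) B := by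
  have hrank : Measurable (δ + π) := hδ.add hπ
  set Q := (P : Measure X).map (δ + π)
  have : IsProbabilityMeasure Q := Measure.isProbabilityMeasure_map hrank.aemeasurable
  have himage : NullMeasurableSet ((δ + π) '' B)
      ((volume.restrict (Ioo 0 1)).map (quantile Q)) := by
    rw [map_quantile]
    exact nullMeasurableSet_image hrank hB (measure_ne_top _ _)
  calc (P : Measure X) B ≤ (P : Measure X) ((δ + π) ⁻¹' ((δ + π) '' B)) :=
        measure_mono (subset_preimage_image _ _)
    _ ≤ Q ((δ + π) '' B) := Measure.le_map_apply hrank.aemeasurable _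
    _ = (volume.restrict (Ioo 0 1)).map (quantile Q) ((δ + π) '' B) := by rw [map_quantile]
    _ = volume (quantile Q ⁻¹' ((δ + π) '' B) ∩ Ioo 0 1) := by
      rw [Measure.map_apply₀ (aemeasurable_quantile Q) himage,
        Measure.restrict_apply' measurableSet_Ioo]
    _ ≤ plausibility (closedFocalSet δ π) B := by
      refine measure_mono ?_
      rintro u ⟨⟨x, hxB, hx⟩, hu⟩
      exact ⟨Ioo_subset_Icc_self hu, x,
        mem_closedFocalSet_of_quantile_eq_add hcloud hcom hδ hπ hP hu hx.symm, hxB⟩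

theorem cloudCredalSet_eq_beliefCredalSet_closedFocalSet (hcloud : IsCloud δ π)
    (hcom : IsComonotonic δ π) (hδ : Measurable δ) (hπ : Measurable π) :
    cloudCredalSet δ π = beliefCredalSet (closedFocalSet δ π) :=
  Subset.antisymm
    (fun _ hP => mem_beliefCredalSet_of_forall_le_plausibility
      (measurableSet_setOf_mem_closedFocalSet hδ hπ)
      fun _ => measure_le_plausibility_closedFocalSet hcloud hcom hδ hπ hP)
    (beliefCredalSet_subset_cloudCredalSet hδ hπ fun _ => Subset.rfl)

theorem IsComonotonic.isRandomSet_focalSet (hcom : IsComonotonic δ π) (hδ : Measurable δ)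
    (hπ : Measurable π) (hempty : volume {α | α ∈ Icc (0 : ℝ) 1 ∧ focalSet δ π α = ∅} = 0) :
    IsRandomSet (focalSet δ π) where
  nullMeasurableSet_subset A hA :=
    (nullMeasurableSet_setOf_subset (measurableSet_setOf_mem_closedFocalSet hδ hπ) hA).congr
      (hcom.setOf_closedFocalSet_subset_ae_eq hempty A)
  mass_empty := hempty

theorem cloudCredalSet_eq_beliefCredalSet_focalSet (hcloud : IsCloud δ π)
    (hcom : IsComonotonic δ π) (hδ : Measurable δ) (hπ : Measurable π)
    (hempty : volume {α | α ∈ Icc (0 : ℝ) 1 ∧ focalSet δ π α = ∅} = 0) :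
    cloudCredalSet δ π = beliefCredalSet (focalSet δ π) := by
  have hbelief : belief (closedFocalSet δ π) = belief (focalSet δ π) :=
    funext fun A => measure_congr (hcom.setOf_closedFocalSet_subset_ae_eq hempty A)
  rw [cloudCredalSet_eq_beliefCredalSet_closedFocalSet hcloud hcom hδ hπ, beliefCredalSet,
    beliefCredalSet, hbelief]

end ComonotonicClouds

section PreconnectedSpace

variable {X : Type*} [TopologicalSpace X] [PreconnectedSpace X] {δ π : X → ℝ}

theorem closedFocalSet_nonempty (hcloud : IsCloud δ π) (hδ : Continuous δ) (hπ : Continuous π)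
    {α : ℝ} (hα : α ∈ Icc (0 : ℝ) 1) : (closedFocalSet δ π α).Nonempty := by
  obtain ⟨x, hx⟩ := hcloud.exists_upper_eq_one
  obtain ⟨y, hy⟩ := hcloud.exists_lower_eq_zero
  have hcover (z : X) : α ≤ π z ∨ δ z ≤ α :=
    (le_total α (δ z)).imp_left fun h => h.trans (hcloud.lower_le_upper z)
  have hinter := isPreconnected_closed_iff.1 isPreconnected_univ {x | α ≤ π x} {x | δ x ≤ α}
    (isClosed_le continuous_const hπ) (isClosed_le hδ continuous_const) (fun z _ => hcover z)
    ⟨x, mem_univ x, hα.2.trans hx.ge⟩ ⟨y, mem_univ y, hy.le.trans hα.1⟩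
  rwa [univ_inter] at hinter

theorem isRandomSet_closedFocalSet [MeasurableSpace X] [StandardBorelSpace X]
    [OpensMeasurableSpace X] (hcloud : IsCloud δ π) (hδ : Continuous δ) (hπ : Continuous π) :
    IsRandomSet (closedFocalSet δ π) where
  nullMeasurableSet_subset _ :=
    nullMeasurableSet_setOf_subset
      (measurableSet_setOf_mem_closedFocalSet hδ.measurable hπ.measurable)
  mass_empty := by
    have hempty : {α | α ∈ Icc (0 : ℝ) 1 ∧ closedFocalSet δ π α = ∅} = ∅ :=
      eq_empty_of_forall_notMem fun _ hα =>
        (closedFocalSet_nonempty hcloud hδ hπ hα.1).ne_empty hα.2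
    rw [hempty, measure_empty]

end PreconnectedSpace

end Clouds

theorem mainTheorem7_general {X : Type*} [TopologicalSpace X] [PreconnectedSpace X]
    [MeasurableSpace X] [StandardBorelSpace X] [OpensMeasurableSpace X] {δ π : X → ℝ}
    (hcloud : Clouds.IsCloud δ π) (hcom : Clouds.IsComonotonic δ π)
    (hδ : Continuous δ) (hπ : Continuous π) :
    (volume {α | α ∈ Set.Icc (0 : ℝ) 1 ∧ Clouds.focalSet δ π α = ∅} = 0 →
      Clouds.IsRandomSet (Clouds.focalSet δ π) ∧
      Clouds.cloudCredalSet δ π = Clouds.beliefCredalSet (Clouds.focalSet δ π)) ∧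
    (Clouds.IsRandomSet (Clouds.closedFocalSet δ π) ∧
      Clouds.cloudCredalSet δ π = Clouds.beliefCredalSet (Clouds.closedFocalSet δ π)) :=
  ⟨fun hempty => ⟨hcom.isRandomSet_focalSet hδ.measurable hπ.measurable hempty,
      Clouds.cloudCredalSet_eq_beliefCredalSet_focalSet hcloud hcom hδ.measurable hπ.measurable
        hempty⟩,
    Clouds.isRandomSet_closedFocalSet hcloud hδ hπ,
    Clouds.cloudCredalSet_eq_beliefCredalSet_closedFocalSet hcloud hcom hδ.measurable
      hπ.measurable⟩

theorem mainTheorem7 (I : Set ℝ) (hI : I.OrdConnected) (δ π : I → ℝ)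
    (hcloud : Clouds.IsCloud δ π) (hcom : Clouds.IsComonotonic δ π)
    (hδ : Continuous δ) (hπ : Continuous π) :
    (volume {α | α ∈ Set.Icc (0 : ℝ) 1 ∧ Clouds.focalSet δ π α = ∅} = 0 →
      Clouds.IsRandomSet (Clouds.focalSet δ π) ∧
      Clouds.cloudCredalSet δ π = Clouds.beliefCredalSet (Clouds.focalSet δ π)) ∧
    (Clouds.IsRandomSet (Clouds.closedFocalSet δ π) ∧
      Clouds.cloudCredalSet δ π = Clouds.beliefCredalSet (Clouds.closedFocalSet δ π)) := by
  have : StandardBorelSpace I := hI.measurableSet.standardBorel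
  have : PreconnectedSpace I := Subtype.preconnectedSpace hI.isPreconnected
  exact mainTheorem7_general hcloud hcom hδ hπ
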